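/- Let $A\in\mathbb R^{n\times n}$, $B^W\in\mathbb R^{n\times n_W}$, $B^P\in\mathbb R^{n\times n_P}$, $H\in\mathbb R^{m\times n}$, let $Q_\omega\ge 0$ and $Q_v\ge 0$ be covariance matrices, and let $p\in[0,1]$. Put $B=[\,B^W\ B^P\,]$. Consider the system with additive noise $$x_{k+1}=Ax_k+Bu_k+B^P\tilde u^P_k+\omega_k,\qquad k\ge 0,$$ with observations $y^W_k=\beta_kx_k$ and $y^P_k=Hx_k+v_k$, where $x_0\sim N(\mu,\sigma)$, $\omega_k\sim N(0,Q_\omega)$, $v_k\sim N(0,Q_v)$, $\beta_k\in\{0,1\}$ with $P(\beta_k=1)=1-p$, and the random variables $x_0,\omega_k,v_k,\beta_k$ ($k\ge0$) are mutually independent. Let $\mathcal F\{Y^W_k\}=\sigma(y^W_0,\dots,y^W_k)$, $\mathcal F\{Y^W_k,Y^P_k\}=\sigma(y^W_0,\dots,y^W_k,y^P_0,\dots,y^P_k)$, $\hat x^W_{k|k}=\mathbb E[x_k\mid\mathcal F\{Y^W_k\}]$ and $\hat x^P_{k|k}=\mathbb E[x_k\mid\mathcal F\{Y^W_k,Y^P_k\}]$.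 Let $Q\in\mathbb R^{n\times n}$, $R^W\in\mathbb R^{n_W\times n_W}$, $R^P\in\mathbb R^{n_P\times n_P}$ be symmetric weighting matrices and $R=\mathrm{diag}(R^W,R^P)$. Consider the coupled algebraic Riccati equations $$P^W=A'P^WA-M'\Gamma^{-1}M+Q,\qquad P^P=A'\Delta A-L'\Omega^{-1}L+Q,$$ where $\Gamma=B'P^WB+R$, $M=B'P^WA$, $\Delta=(1-p)P^W+pP^P$, $\Omega=B^{P\prime}\Delta B^P+R^P$, $L=B^{P\prime}\Delta A$. Assume: 1. $R^P>0$, $R^W>0$ and $Q\ge0$; 2. $(A,Q^{1/2})$ is observable and $(A,H)$ is detectable; 3. $(A,[\,B^W\ B^P\,])$ is stabilizable; 4. $(A,B^P)$ is stabilizable and, for the solution $P^W>0$ of the first Riccati equation, $(A,D)$ is observable for some $D\in\mathbb R^{n\times n}$ with $pQ+(1-p)P^W=DD'$; 5. for the solution $(P^W,P^P)$ of the Riccati equations with $P^W>0$ and $\Delta>0$, one has $\sqrt p\,|\lambda_{\max}(A-B^P\Omega^{-1}L)|<1$, where $|\lambda_{\max}(\cdot)|$ is the largest modulus of a (complex)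 eigenvalue. Then the system is bounded in the mean-square sense: there are constant matrices $L^W\in\mathbb R^{(n_W+n_P)\times n}$ and $L^P\in\mathbb R^{n_P\times n}$ such that, for every initial mean $\mu$ and covariance $\sigma\ge0$, the closed loop under $u_k=L^W\hat x^W_{k|k}$ and $\tilde u^P_k=L^P(\hat x^P_{k|k}-\hat x^W_{k|k})$ satisfies $\sup_{k\ge0}\mathbb E[x_k'x_k]<\infty$. -/

import Mathlib

open MeasureTheory ProbabilityTheory Matrix
open scoped ENNReal MatrixOrder

universe u

noncomputable section

namespace NCS

/-! ### Linear-systems vocabulary -/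

/-- `|λ_max(M)|`: the largest modulus of a complex eigenvalue of the real square matrix `M`. -/
def lamMaxAbs {n : ℕ} (M : Matrix (Fin n) (Fin n) ℝ) : ℝ≥0∞ :=
  spectralRadius ℂ (M.map (algebraMap ℝ ℂ))

/-- `(A, B)` is stabilizable: some state feedback puts all eigenvalues of `A + B K` in the open
unit disc. -/
def Stabilizable {n : ℕ} {ι : Type*} [Fintype ι] (A : Matrix (Fin n) (Fin n) ℝ)
    (B : Matrix (Fin n) ι ℝ) : Prop :=
  ∃ K : Matrix ι (Fin n) ℝ, lamMaxAbs (A + B * K) < 1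

/-- `(A, H)` is detectable: some output injection puts all eigenvalues of `A + K H` in the open
unit disc. -/
def Detectable {n : ℕ} {ι : Type*} [Fintype ι] (A : Matrix (Fin n) (Fin n) ℝ)
    (H : Matrix ι (Fin n) ℝ) : Prop :=
  ∃ K : Matrix (Fin n) ι ℝ, lamMaxAbs (A + K * H) < 1

/-- `(A, C)` is observable: only the zero initial state gives the zero output `C Aᵏ x`. -/
def Observable {n : ℕ} {ι : Type*} [Fintype ι] (A : Matrix (Fin n) (Fin n) ℝ)
    (C : Matrix ι (Fin n) ℝ) : Prop :=
  ∀ x : Fin n → ℝ, (∀ k : ℕ, (C * A ^ k) *ᵥ x = 0) → x = 0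

/-! ### The networked control system -/

/-- The data of the plant `x (k+1) = A x k + B^W u^W k + B^P u^P k + ω k` with embedded sensor
`y^P k = H x k + v k` and lossy channel `y^W k = β k • x k`. -/
structure System (n nW nP m : ℕ) where
  A : Matrix (Fin n) (Fin n) ℝ
  BW : Matrix (Fin n) (Fin nW) ℝ
  BP : Matrix (Fin n) (Fin nP) ℝ
  H : Matrix (Fin m) (Fin n) ℝ
  /-- covariance of the plant noise `ω k` -/
  Qω : Matrix (Fin n) (Fin n) ℝ
  /-- covariance of the sensor noise `v k` -/
  Qv : Matrix (Fin m) (Fin m) ℝ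
  /-- packet dropout probability -/
  p : ℝ

/-- The weighting matrices `Q`, `R^W`, `R^P` of the quadratic performance index. -/
structure Weights (n nW nP : ℕ) where
  Q : Matrix (Fin n) (Fin n) ℝ
  RW : Matrix (Fin nW) (Fin nW) ℝ
  RP : Matrix (Fin nP) (Fin nP) ℝ

/-- `R = diag(R^W, R^P)`. -/
def Weights.R {n nW nP : ℕ} (w : Weights n nW nP) : Matrix (Fin nW ⊕ Fin nP) (Fin nW ⊕ Fin nP) ℝ :=
  fromBlocks w.RW 0 0 w.RP

namespace System

variable {n nW nP m : ℕ}

/-- `B = [B^W  B^P]`. -/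
def B (S : System n nW nP m) : Matrix (Fin n) (Fin nW ⊕ Fin nP) ℝ :=
  fromCols S.BW S.BP

/-! ### The coupled algebraic Riccati equations -/

/-- `Γ = B' P^W B + R`. -/
def Gam (S : System n nW nP m) (w : Weights n nW nP) (PW : Matrix (Fin n) (Fin n) ℝ) :
    Matrix (Fin nW ⊕ Fin nP) (Fin nW ⊕ Fin nP) ℝ :=
  S.Bᵀ * PW * S.B + w.R

/-- `M = B' P^W A`. -/
def M (S : System n nW nP m) (PW : Matrix (Fin n) (Fin n) ℝ) :
    Matrix (Fin nW ⊕ Fin nP) (Fin n) ℝ :=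
  S.Bᵀ * PW * S.A

/-- `Δ = (1 - p) P^W + p P^P`. -/
def Del (S : System n nW nP m) (PW PP : Matrix (Fin n) (Fin n) ℝ) :
    Matrix (Fin n) (Fin n) ℝ :=
  (1 - S.p) • PW + S.p • PP

/-- `Ω = B^P' Δ B^P + R^P`. -/
def Omg (S : System n nW nP m) (w : Weights n nW nP) (PW PP : Matrix (Fin n) (Fin n) ℝ) :
    Matrix (Fin nP) (Fin nP) ℝ :=
  S.BPᵀ * S.Del PW PP * S.BP + w.RP

/-- `L = B^P' Δ A`. -/
def L (S : System n nW nP m) (PW PP : Matrix (Fin n) (Fin n) ℝ) :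
    Matrix (Fin nP) (Fin n) ℝ :=
  S.BPᵀ * S.Del PW PP * S.A

/-- The first Riccati equation `P^W = A' P^W A - M' Γ⁻¹ M + Q`. -/
def RiccatiW (S : System n nW nP m) (w : Weights n nW nP) (PW : Matrix (Fin n) (Fin n) ℝ) :
    Prop :=
  PW = S.Aᵀ * PW * S.A - (S.M PW)ᵀ * (S.Gam w PW)⁻¹ * S.M PW + w.Q

/-- The second Riccati equation `P^P = A' Δ A - L' Ω⁻¹ L + Q`. -/
def RiccatiP (S : System n nW nP m) (w : Weights n nW nP) (PW PP : Matrix (Fin n) (Fin n) ℝ) :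
    Prop :=
  PP = S.Aᵀ * S.Del PW PP * S.A - (S.L PW PP)ᵀ * (S.Omg w PW PP)⁻¹ * S.L PW PP + w.Q

end System

/-! ### The randomness -/

/-- Labels of the primitive random variables: `x 0`, `ω k`, `v k`, `β k`. -/
inductive Source where
  | init : Source
  | plant (k : ℕ) : Source
  | sensor (k : ℕ) : Source
  | channel (k : ℕ) : Source

/-- The σ-algebra generated by each primitive random variable. -/
@[reducible] def sourceSigma {Ω : Type*} {n m : ℕ} (x₀ : Ω → EuclideanSpace ℝ (Fin n))
    (ω : ℕ → Ω → EuclideanSpace ℝ (Fin n)) (v : ℕ → Ω → EuclideanSpace ℝ (Fin m))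
    (β : ℕ → Ω → ℝ) : Source → MeasurableSpace Ω
  | .init => MeasurableSpace.comap x₀ inferInstance
  | .plant k => MeasurableSpace.comap (ω k) inferInstance
  | .sensor k => MeasurableSpace.comap (v k) inferInstance
  | .channel k => MeasurableSpace.comap (β k) inferInstance

/-- On the probability space `(Ω, P)`: `x₀ ~ N(μ, σ)`, `ω k ~ N(0, Q_ω)`, `v k ~ N(0, Q_v)`,
`β k` is Bernoulli with `P(β k = 1) = 1 - p`, and all of them are mutually independent. -/
structure IsRandomInput {Ω : Type*} [MeasurableSpace Ω] {n nW nP m : ℕ} (S : System n nW nP m)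
    (P : Measure Ω) (μ : EuclideanSpace ℝ (Fin n)) (σ : Matrix (Fin n) (Fin n) ℝ)
    (x₀ : Ω → EuclideanSpace ℝ (Fin n))
    (ω : ℕ → Ω → EuclideanSpace ℝ (Fin n)) (v : ℕ → Ω → EuclideanSpace ℝ (Fin m))
    (β : ℕ → Ω → ℝ) : Prop where
  measurable_init : Measurable x₀
  measurable_plant : ∀ k, Measurable (ω k)
  measurable_sensor : ∀ k, Measurable (v k)
  measurable_channel : ∀ k, Measurable (β k)
  law_init : P.map x₀ = multivariateGaussian μ σ
  law_plant : ∀ k, P.map (ω k) = multivariateGaussian 0 S.Qω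
  law_sensor : ∀ k, P.map (v k) = multivariateGaussian 0 S.Qv
  channel_zero_or_one : ∀ k a, β k a = 0 ∨ β k a = 1
  law_channel : ∀ k, P {a | β k a = 1} = ENNReal.ofReal (1 - S.p)
  indep : iIndep (sourceSigma x₀ ω v β) P

/-! ### The closed loop -/

/-- At a time `k`: the state `x k`, and the information σ-algebras `F{Y^W_k}` of the remote
controller and `F{Y^W_k, Y^P_k}` of the embedded controller. -/
structure LoopState (Ω : Type*) (n : ℕ) where
  x : Ω → EuclideanSpace ℝ (Fin n)
  infoW : MeasurableSpace Ω
  infoP : MeasurableSpace Ω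

/-- `x̂^W_{k|k} = E[x k | F{Y^W_k}]`. -/
def LoopState.estW {Ω : Type*} [MeasurableSpace Ω] {n : ℕ} (P : Measure Ω)
    (s : LoopState Ω n) : Ω → EuclideanSpace ℝ (Fin n) :=
  condExp s.infoW P s.x

/-- `x̂^P_{k|k} = E[x k | F{Y^W_k, Y^P_k}]`. -/
def LoopState.estP {Ω : Type*} [MeasurableSpace Ω] {n : ℕ} (P : Measure Ω)
    (s : LoopState Ω n) : Ω → EuclideanSpace ℝ (Fin n) :=
  condExp s.infoP P s.x

/-- The σ-algebra of the new channel output `y^W = β • x`. -/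
@[reducible] def outW {Ω : Type*} {n : ℕ} (b : Ω → ℝ) (x : Ω → EuclideanSpace ℝ (Fin n)) :
    MeasurableSpace Ω :=
  MeasurableSpace.comap (fun a => b a • x a) inferInstance

/-- The σ-algebra of the new sensor output `y^P = H x + v`. -/
@[reducible] def outP {Ω : Type*} {n m : ℕ} (H : Matrix (Fin m) (Fin n) ℝ)
    (v : Ω → EuclideanSpace ℝ (Fin m)) (x : Ω → EuclideanSpace ℝ (Fin n)) :
    MeasurableSpace Ω :=
  MeasurableSpace.comap (fun a => toEuclideanLin H (x a) + v a) inferInstance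

/-- The closed loop of `x (k+1) = A x k + B u k + B^P ũ^P k + ω k` under
`u k = L^W x̂^W_{k|k}` and `ũ^P k = L^P (x̂^P_{k|k} - x̂^W_{k|k})`. -/
def closedLoop {Ω : Type*} [MeasurableSpace Ω] {n nW nP m : ℕ} (S : System n nW nP m)
    (LW : Matrix (Fin nW ⊕ Fin nP) (Fin n) ℝ) (LP : Matrix (Fin nP) (Fin n) ℝ)
    (P : Measure Ω) (x₀ : Ω → EuclideanSpace ℝ (Fin n))
    (ω : ℕ → Ω → EuclideanSpace ℝ (Fin n)) (v : ℕ → Ω → EuclideanSpace ℝ (Fin m))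
    (β : ℕ → Ω → ℝ) : ℕ → LoopState Ω n
  | 0 =>
    { x := x₀
      infoW := outW (β 0) x₀
      infoP := outW (β 0) x₀ ⊔ outP S.H (v 0) x₀ }
  | k + 1 =>
    let s := closedLoop S LW LP P x₀ ω v β k
    let u : Ω → EuclideanSpace ℝ (Fin nW ⊕ Fin nP) := fun a => toEuclideanLin LW (s.estW P a)
    let uP : Ω → EuclideanSpace ℝ (Fin nP) :=
      fun a => toEuclideanLin LP (s.estP P a - s.estW P a)
    let x : Ω → EuclideanSpace ℝ (Fin n) := fun a =>
      toEuclideanLin S.A (s.x a) + toEuclideanLin S.B (u a) + toEuclideanLin S.BP (uP a) + ω k a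
    { x := x
      infoW := s.infoW ⊔ outW (β (k + 1)) x
      infoP := s.infoP ⊔ (outW (β (k + 1)) x ⊔ outP S.H (v (k + 1)) x) }

/-- The system with additive noise is bounded in the mean-square sense: there are constant gains
`L^W`, `L^P` such that, for every initial law `N(μ, σ)`, the closed loop satisfies
`sup_k E[x_k' x_k] < ∞`. -/
def System.MeanSquareBounded {n nW nP m : ℕ} (S : System n nW nP m) : Prop :=
  ∃ (LW : Matrix (Fin nW ⊕ Fin nP) (Fin n) ℝ) (LP : Matrix (Fin nP) (Fin n) ℝ),
    ∀ (Ω : Type u) [MeasurableSpace Ω] (P : Measure Ω) [IsProbabilityMeasure P]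
      (μ : EuclideanSpace ℝ (Fin n)) (σ : Matrix (Fin n) (Fin n) ℝ)
      (x₀ : Ω → EuclideanSpace ℝ (Fin n)) (ω : ℕ → Ω → EuclideanSpace ℝ (Fin n))
      (v : ℕ → Ω → EuclideanSpace ℝ (Fin m)) (β : ℕ → Ω → ℝ),
      σ.PosSemidef → IsRandomInput S P μ σ x₀ ω v β →
      ∃ C : ℝ, ∀ k : ℕ,
        Integrable (fun a => ‖(closedLoop S LW LP P x₀ ω v β k).x a‖ ^ 2) P ∧
        ∫ a, ‖(closedLoop S LW LP P x₀ ω v β k).x a‖ ^ 2 ∂P ≤ C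

end NCS

end

/-! Take for `LW` and `LP` the gains that make `A + B * LW` and `A + BP * LP` Schur stable. The loop
is then a cascade of three stable recursions, each driven by the noise and by the signals bounded
before it. The embedded error is compared with that of a Luenberger observer built from
detectability. For the remote error, replacing `x̂^P` by `x` in `ũ^P` leaves dynamics `A + BP * LP`
with an input known remotely and a disturbance proportional to the embedded error; no received
packet is needed. Finally `x` follows `A + B * LW`, forced by both errors and the noise. The two
tools are `L2Bounded.of_recursion` (a power-summable recursion keeps second moments bounded) and
`L2Bounded.sub_condExp` (the conditional mean is nearly as good as any adapted estimator), joined in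
`L2Bounded.estimation_error`. -/

namespace NCS

open Filter Topology
open scoped NNReal

/-! ### Schur stability and summability of powers. -/

section Stability

theorem exists_norm_le_mul_of_finiteDimensional {V W : Type*} [NormedAddCommGroup V]
    [NormedSpace ℝ V] [FiniteDimensional ℝ V] [NormedAddCommGroup W] [NormedSpace ℝ W]
    (f : V →ₗ[ℝ] W) : ∃ C : ℝ, ∀ v, ‖f v‖ ≤ C * ‖v‖ :=
  ⟨_, f.toContinuousLinearMap.le_opNorm⟩

/-- The powers of a real matrix all of whose eigenvalues lie in the open unit disc are summable
in operator norm. -/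
theorem summable_norm_pow_of_lamMaxAbs_lt_one {n : ℕ} {M : Matrix (Fin n) (Fin n) ℝ}
    (hM : lamMaxAbs M < 1) :
    Summable fun k : ℕ => ‖(toEuclideanCLM (n := Fin n) (𝕜 := ℝ) M) ^ k‖ := by
  -- The row-sum norm gives a Banach algebra and depends only on absolute values of entries, so
  -- complexification preserves it.
  let _ : NormedRing (Matrix (Fin n) (Fin n) ℂ) := Matrix.linftyOpNormedRing
  let _ : NormedAlgebra ℂ (Matrix (Fin n) (Fin n) ℂ) := Matrix.linftyOpNormedAlgebra
  let _ : NormedRing (Matrix (Fin n) (Fin n) ℝ) := Matrix.linftyOpNormedRing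
  let _ : NormedAlgebra ℝ (Matrix (Fin n) (Fin n) ℝ) := Matrix.linftyOpNormedAlgebra
  obtain ⟨r, hr, hr1⟩ := ENNReal.lt_iff_exists_nnreal_btwn.1 hM
  have hr1' : r < 1 := by exact_mod_cast hr1
  have hnorm (N : Matrix (Fin n) (Fin n) ℝ) : ‖N.map (algebraMap ℝ ℂ)‖ = ‖N‖ := by
    simp only [Matrix.linfty_opNorm_def, Matrix.map_apply, Complex.coe_algebraMap,
      Complex.nnnorm_real]
  have hpow (k : ℕ) : ‖(M.map (algebraMap ℝ ℂ)) ^ k‖ = ‖M ^ k‖ := by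
    rw [← hnorm (M ^ k), ← RingHom.mapMatrix_apply, ← RingHom.mapMatrix_apply, map_pow]
  -- Gelfand's formula, with `r` strictly between the spectral radius and 1.
  have hev : ∀ᶠ k : ℕ in atTop, ‖M ^ k‖ ≤ (r : ℝ) ^ k := by
    have h := (spectrum.pow_nnnorm_pow_one_div_tendsto_nhds_spectralRadius
      (M.map (algebraMap ℝ ℂ))).eventually_lt_const hr
    filter_upwards [h, eventually_gt_atTop 0] with k hk hk0
    have hk' : (0 : ℝ) < k := by exact_mod_cast hk0
    rw [one_div, ENNReal.rpow_inv_lt_iff hk', ENNReal.rpow_natCast] at hk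
    rw [← hpow, ← coe_nnnorm]
    exact_mod_cast hk.le
  have hsum : Summable fun k : ℕ => ‖M ^ k‖ :=
    Summable.of_norm_bounded_eventually_nat
      (summable_geometric_of_lt_one r.2 (by exact_mod_cast hr1')) (by simpa using hev)
  obtain ⟨C, hC⟩ := exists_norm_le_mul_of_finiteDimensional
    ((toEuclideanCLM (n := Fin n) (𝕜 := ℝ)).toAlgEquiv.toLinearMap)
  refine Summable.of_nonneg_of_le (fun k => norm_nonneg _) (fun k => ?_) (hsum.mul_left C)
  rw [← map_pow]
  exact hC (M ^ k)

end Stability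

/-! ### Mean-square bounds for recursions and conditional means. -/

section MeanSquare

variable {Ω : Type*} {m₀ : MeasurableSpace Ω} {P : Measure Ω}
  {E F : Type*} [NormedAddCommGroup E] [NormedAddCommGroup F]

/-- A random sequence whose second moments are uniformly bounded. -/
def L2Bounded (P : Measure Ω) (f : ℕ → Ω → E) : Prop :=
  ∃ C : ℝ≥0, ∀ k, AEStronglyMeasurable (f k) P ∧ eLpNorm (f k) 2 P ≤ C

theorem L2Bounded.memLp {f : ℕ → Ω → E} (hf : L2Bounded P f) (k : ℕ) : MemLp (f k) 2 P := by
  obtain ⟨C, hC⟩ := hf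
  exact ⟨(hC k).1, (hC k).2.trans_lt ENNReal.coe_lt_top⟩

theorem L2Bounded.add {f g : ℕ → Ω → E} (hf : L2Bounded P f) (hg : L2Bounded P g) :
    L2Bounded P (fun k a => f k a + g k a) := by
  obtain ⟨C, hC⟩ := hf
  obtain ⟨D, hD⟩ := hg
  refine ⟨C + D, fun k => ⟨(hC k).1.add (hD k).1, ?_⟩⟩
  rw [ENNReal.coe_add]
  exact (eLpNorm_add_le (hC k).1 (hD k).1 (by norm_num)).trans (add_le_add (hC k).2 (hD k).2)

theorem L2Bounded.sub {f g : ℕ → Ω → E} (hf : L2Bounded P f) (hg : L2Bounded P g) :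
    L2Bounded P (fun k a => f k a - g k a) := by
  obtain ⟨C, hC⟩ := hf
  obtain ⟨D, hD⟩ := hg
  refine ⟨C + D, fun k => ⟨(hC k).1.sub (hD k).1, ?_⟩⟩
  rw [ENNReal.coe_add]
  exact (eLpNorm_sub_le (hC k).1 (hD k).1 (by norm_num)).trans (add_le_add (hC k).2 (hD k).2)

variable [NormedSpace ℝ E] [NormedSpace ℝ F]

theorem eLpNorm_clm_le (T : E →L[ℝ] F) (f : Ω → E) :
    eLpNorm (fun a => T (f a)) 2 P ≤ ‖T‖₊ * eLpNorm f 2 P := by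
  have h := eLpNorm_le_nnreal_smul_eLpNorm_of_ae_le_mul (μ := P) (f := fun a => T (f a)) (g := f)
    (c := ‖T‖₊) (ae_of_all _ fun a => T.le_opNNNorm (f a)) 2
  simpa [ENNReal.smul_def] using h

theorem L2Bounded.clm {f : ℕ → Ω → E} (hf : L2Bounded P f) (T : E →L[ℝ] F) :
    L2Bounded P (fun k a => T (f k a)) := by
  obtain ⟨C, hC⟩ := hf
  refine ⟨‖T‖₊ * C, fun k => ⟨T.continuous.comp_aestronglyMeasurable (hC k).1, ?_⟩⟩
  rw [ENNReal.coe_mul]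
  exact (eLpNorm_clm_le T _).trans (mul_le_mul_right (hC k).2 _)

theorem L2Bounded.lin [FiniteDimensional ℝ E] {f : ℕ → Ω → E} (hf : L2Bounded P f)
    (T : E →ₗ[ℝ] F) : L2Bounded P (fun k a => T (f k a)) :=
  hf.clm T.toContinuousLinearMap

/-- A power-summable linear recursion driven by a mean-square bounded input is mean-square
bounded. -/
theorem L2Bounded.of_recursion {T : E →L[ℝ] E} (hT : Summable fun k : ℕ => ‖T ^ k‖)
    {e d : ℕ → Ω → E} (he : MemLp (e 0) 2 P) (hd : L2Bounded P d)
    (hrec : ∀ k a, e (k + 1) a = T (e k a) + d k a) : L2Bounded P e := by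
  obtain ⟨D, hD⟩ := hd
  have hmeas : ∀ k, AEStronglyMeasurable (e k) P := by
    intro k
    induction k with
    | zero => exact he.1
    | succ k ih =>
      rw [show e (k + 1) = (fun a => T (e k a)) + d k from funext (hrec k)]
      exact (T.continuous.comp_aestronglyMeasurable ih).add (hD k).1
  have hTn : Summable fun k : ℕ => ‖T ^ k‖₊ := by
    rw [← NNReal.summable_coe]; exact hT
  -- Unrolling the recursion backwards in time: peeling off the latest input turns `T ^ j` into `T ^
  -- (j + 1)`, hence the quantifier over `j`. Only `j = 0` is used afterwards.
  have hexp : ∀ k j, eLpNorm (fun a => (T ^ j) (e k a)) 2 P ≤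
      ‖T ^ (j + k)‖₊ * eLpNorm (e 0) 2 P
        + (∑ i ∈ Finset.range k, (‖T ^ (j + i)‖₊ : ℝ≥0∞)) * D := by
    intro k
    induction k with
    | zero => intro j; exact (eLpNorm_clm_le _ _).trans le_self_add
    | succ k ih =>
      intro j
      have hsplit : (fun a => (T ^ j) (e (k + 1) a))
          = (fun a => (T ^ (j + 1)) (e k a)) + fun a => (T ^ j) (d k a) := by
        funext a
        simp [hrec, pow_succ]
      have hd' : eLpNorm (fun a => (T ^ j) (d k a)) 2 P ≤ ‖T ^ j‖₊ * D :=
        (eLpNorm_clm_le _ _).trans (mul_le_mul_right (hD k).2 _)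
      rw [hsplit, Finset.sum_range_succ', add_mul, ← add_assoc]
      refine (eLpNorm_add_le ((T ^ (j + 1)).continuous.comp_aestronglyMeasurable (hmeas k))
        ((T ^ j).continuous.comp_aestronglyMeasurable (hD k).1) (by norm_num)).trans
        (add_le_add ?_ hd')
      have hshift : ∀ i, j + 1 + i = j + (i + 1) := fun i => by omega
      simpa only [hshift] using ih (j + 1)
  refine ⟨(∑' i, ‖T ^ i‖₊) * (eLpNorm (e 0) 2 P).toNNReal + (∑' i, ‖T ^ i‖₊) * D,
    fun k => ⟨hmeas k, ?_⟩⟩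
  have h0 := hexp k 0
  simp only [pow_zero, one_apply_eq_self, zero_add] at h0
  refine h0.trans ?_
  rw [ENNReal.coe_add, ENNReal.coe_mul, ENNReal.coe_mul, ENNReal.coe_toNNReal he.2.ne]
  gcongr
  · exact hTn.le_tsum k fun _ _ => zero_le
  · rw [← ENNReal.ofNNReal_finsetSum]
    exact_mod_cast hTn.sum_le_tsum _ fun _ _ => zero_le

/-- The conditional mean is, up to a factor two, as good in mean square as any estimator that is
adapted to the same information. -/
theorem L2Bounded.sub_condExp [CompleteSpace E] [IsProbabilityMeasure P]
    {𝓕 : ℕ → MeasurableSpace Ω} (h𝓕 : ∀ k, 𝓕 k ≤ m₀) {x z : ℕ → Ω → E}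
    (hx : ∀ k, MemLp (x k) 2 P) (hz : ∀ k, StronglyMeasurable[𝓕 k] (z k))
    (h : L2Bounded P fun k a => x k a - z k a) :
    L2Bounded P fun k a => x k a - (P[x k | 𝓕 k]) a := by
  -- As `z` is adapted, `x - E[x|𝓕] = (x - z) - E[x - z|𝓕]`, and conditional expectation contracts
  -- `L²`.
  have hcond : L2Bounded P fun k => P[fun a => x k a - z k a | 𝓕 k] := by
    obtain ⟨C, hC⟩ := h
    exact ⟨C, fun k => ⟨(stronglyMeasurable_condExp.mono (h𝓕 k)).aestronglyMeasurable,
      (eLpNorm_condExp_le_eLpNorm _ (by norm_num)).trans (hC k).2⟩⟩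
  obtain ⟨C, hC⟩ := h.sub hcond
  refine ⟨C, fun k => ?_⟩
  have hxi : Integrable (x k) P := (hx k).integrable (by norm_num)
  have hzi : Integrable (z k) P := by
    have := hxi.sub ((h.memLp k).integrable (by norm_num))
    simpa [Pi.sub_def] using this
  have hae : (fun a => x k a - z k a - (P[fun a => x k a - z k a | 𝓕 k]) a)
      =ᵐ[P] fun a => x k a - (P[x k | 𝓕 k]) a := by
    filter_upwards [condExp_sub hxi hzi (𝓕 k)] with a ha
    rw [show (fun a => x k a - z k a) = x k - z k from rfl, ha, Pi.sub_apply,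
      condExp_of_stronglyMeasurable (h𝓕 k) (hz k) hzi]
    abel
  exact ⟨(hC k).1.congr hae, (eLpNorm_congr_ae hae).symm.trans_le (hC k).2⟩

/-- The linear observer with dynamics `T` and injected signal `φ`, started at zero. -/
def observer (T : E →L[ℝ] E) (φ : ℕ → Ω → E) : ℕ → Ω → E
  | 0 => fun _ => 0
  | k + 1 => fun a => T (observer T φ k a) + φ k a

theorem stronglyMeasurable_observer {𝓕 : ℕ → MeasurableSpace Ω} (h𝓕 : Monotone 𝓕)
    (T : E →L[ℝ] E) {φ : ℕ → Ω → E} (hφ : ∀ k, StronglyMeasurable[𝓕 k] (φ k)) (k : ℕ) :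
    StronglyMeasurable[𝓕 k] (observer T φ k) := by
  induction k with
  | zero => exact stronglyMeasurable_const
  | succ k ih =>
    exact ((T.continuous.comp_stronglyMeasurable ih).add (hφ k)).mono (h𝓕 k.le_succ)

/-- If, up to a mean-square bounded disturbance, the state follows a power-summable recursion whose
input is known to the observer, then the error of the conditional mean is mean-square bounded. -/
theorem L2Bounded.estimation_error [CompleteSpace E] [IsProbabilityMeasure P]
    {𝓕 : ℕ → MeasurableSpace Ω} (hmono : Monotone 𝓕) (h𝓕 : ∀ k, 𝓕 k ≤ m₀)
    {T : E →L[ℝ] E} (hT : Summable fun k : ℕ => ‖T ^ k‖) {x φ d : ℕ → Ω → E}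
    (hx : ∀ k, MemLp (x k) 2 P) (hφ : ∀ k, StronglyMeasurable[𝓕 k] (φ k)) (hd : L2Bounded P d)
    (hrec : ∀ k a, x (k + 1) a = T (x k a) + φ k a + d k a) :
    L2Bounded P fun k a => x k a - (P[x k | 𝓕 k]) a := by
  refine L2Bounded.sub_condExp h𝓕 hx (stronglyMeasurable_observer hmono T hφ)
    (L2Bounded.of_recursion hT (d := d) ?_ hd fun k a => ?_)
  -- The observer starts at zero, so the initial error is `x 0`; afterwards `φ` cancels from the
  -- error.
  · simpa [observer] using hx 0
  · simp only [observer, hrec, map_sub]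
    abel

end MeanSquare

/-! ### The closed loop as a cascade of stable recursions. -/

section ClosedLoop

theorem toEuclideanCLM_add_mul {ι κ : Type*} [Fintype ι] [Fintype κ]
    [DecidableEq ι] [DecidableEq κ] (A : Matrix κ κ ℝ) (B : Matrix κ ι ℝ) (K : Matrix ι κ ℝ)
    (v : EuclideanSpace ℝ κ) :
    toEuclideanCLM (n := κ) (𝕜 := ℝ) (A + B * K) v
      = toEuclideanLin A v + toEuclideanLin B (toEuclideanLin K v) := by
  rw [map_add, _root_.add_apply]
  congr 1
  exact congrArg (WithLp.toLp 2) (Matrix.mulVec_mulVec _ _ _).symm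

theorem memLp_two_of_map_eq_multivariateGaussian {Ω : Type*} [MeasurableSpace Ω] {P : Measure Ω}
    {n : ℕ} {X : Ω → EuclideanSpace ℝ (Fin n)} (hX : Measurable X) {μ : EuclideanSpace ℝ (Fin n)}
    {σ : Matrix (Fin n) (Fin n) ℝ} (hlaw : P.map X = multivariateGaussian μ σ) : MemLp X 2 P := by
  have h : MemLp id 2 (P.map X) := by
    rw [hlaw]; exact IsGaussian.memLp_two_id
  exact (memLp_map_measure_iff aestronglyMeasurable_id hX.aemeasurable).1 h

theorem L2Bounded.of_law_eq_multivariateGaussian {Ω : Type*} [MeasurableSpace Ω] {P : Measure Ω}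
    {n : ℕ} {X : ℕ → Ω → EuclideanSpace ℝ (Fin n)} (hX : ∀ k, Measurable (X k))
    {μ : EuclideanSpace ℝ (Fin n)} {σ : Matrix (Fin n) (Fin n) ℝ}
    (hlaw : ∀ k, P.map (X k) = multivariateGaussian μ σ) : L2Bounded P X := by
  refine ⟨(eLpNorm id 2 (multivariateGaussian μ σ)).toNNReal,
    fun k => ⟨(hX k).aestronglyMeasurable, ?_⟩⟩
  rw [ENNReal.coe_toNNReal IsGaussian.memLp_two_id.2.ne, ← hlaw k,
    eLpNorm_map_measure aestronglyMeasurable_id (hX k).aemeasurable, Function.id_comp]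

variable {Ω : Type*} [MeasurableSpace Ω] {n nW nP m : ℕ} {S : System n nW nP m}
  {LW : Matrix (Fin nW ⊕ Fin nP) (Fin n) ℝ} {LP : Matrix (Fin nP) (Fin n) ℝ}
  {P : Measure Ω} {x₀ : Ω → EuclideanSpace ℝ (Fin n)}
  {ω : ℕ → Ω → EuclideanSpace ℝ (Fin n)} {v : ℕ → Ω → EuclideanSpace ℝ (Fin m)}
  {β : ℕ → Ω → ℝ}

theorem closedLoop_x_succ (k : ℕ) (a : Ω) :
    (closedLoop S LW LP P x₀ ω v β (k + 1)).x a =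
      toEuclideanLin S.A ((closedLoop S LW LP P x₀ ω v β k).x a)
        + toEuclideanLin S.B (toEuclideanLin LW ((closedLoop S LW LP P x₀ ω v β k).estW P a))
        + toEuclideanLin S.BP (toEuclideanLin LP ((closedLoop S LW LP P x₀ ω v β k).estP P a
          - (closedLoop S LW LP P x₀ ω v β k).estW P a))
        + ω k a := rfl

theorem closedLoop_infoW_mono :
    Monotone fun k => (closedLoop S LW LP P x₀ ω v β k).infoW :=
  monotone_nat_of_le_succ fun _ => le_sup_left

theorem closedLoop_infoP_mono :
    Monotone fun k => (closedLoop S LW LP P x₀ ω v β k).infoP :=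
  monotone_nat_of_le_succ fun _ => le_sup_left

theorem closedLoop_infoW_le_infoP (k : ℕ) :
    (closedLoop S LW LP P x₀ ω v β k).infoW ≤ (closedLoop S LW LP P x₀ ω v β k).infoP := by
  induction k with
  | zero => exact le_sup_left
  | succ k ih => exact sup_le_sup ih le_sup_left

theorem outP_le_closedLoop_infoP (k : ℕ) :
    outP S.H (v k) (closedLoop S LW LP P x₀ ω v β k).x
      ≤ (closedLoop S LW LP P x₀ ω v β k).infoP := by
  cases k with
  | zero => exact le_sup_right
  | succ k => exact le_sup_right.trans le_sup_right

theorem outW_le {b : Ω → ℝ} {x : Ω → EuclideanSpace ℝ (Fin n)} (hb : Measurable b)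
    (hx : Measurable x) : outW b x ≤ ‹MeasurableSpace Ω› :=
  (hb.smul hx).comap_le

theorem outP_le (H : Matrix (Fin m) (Fin n) ℝ) {w : Ω → EuclideanSpace ℝ (Fin m)}
    {x : Ω → EuclideanSpace ℝ (Fin n)} (hw : Measurable w) (hx : Measurable x) :
    outP H w x ≤ ‹MeasurableSpace Ω› :=
  (((toEuclideanLin H).continuous_of_finiteDimensional.measurable.comp hx).add hw).comap_le

/-- The claims need a joint induction: the next state contains conditional means, measurable because
`infoP` lies in the ambient σ-algebra, and the next `infoP` stays there because the next state is
measurable. -/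
theorem closedLoop_measurable_memLp (hx₀ : Measurable x₀) (hω : ∀ k, Measurable (ω k))
    (hv : ∀ k, Measurable (v k)) (hβ : ∀ k, Measurable (β k)) (hx₀2 : MemLp x₀ 2 P)
    (hω2 : ∀ k, MemLp (ω k) 2 P) (k : ℕ) :
    Measurable (closedLoop S LW LP P x₀ ω v β k).x ∧
      (closedLoop S LW LP P x₀ ω v β k).infoP ≤ ‹MeasurableSpace Ω› ∧
      MemLp (closedLoop S LW LP P x₀ ω v β k).x 2 P := by
  induction k with
  | zero => exact ⟨hx₀, sup_le (outW_le (hβ 0) hx₀) (outP_le _ (hv 0) hx₀), hx₀2⟩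
  | succ k ih =>
    obtain ⟨hx, hi, hx2⟩ := ih
    have hP : Measurable ((closedLoop S LW LP P x₀ ω v β k).estP P) :=
      (stronglyMeasurable_condExp.mono hi).measurable
    have hW : Measurable ((closedLoop S LW LP P x₀ ω v β k).estW P) :=
      (stronglyMeasurable_condExp.mono ((closedLoop_infoW_le_infoP k).trans hi)).measurable
    have hP2 : MemLp ((closedLoop S LW LP P x₀ ω v β k).estP P) 2 P := hx2.condExp (by norm_num)
    have hW2 : MemLp ((closedLoop S LW LP P x₀ ω v β k).estW P) 2 P := hx2.condExp (by norm_num)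
    have hx' : Measurable (closedLoop S LW LP P x₀ ω v β (k + 1)).x :=
      ((((toEuclideanLin S.A).continuous_of_finiteDimensional.measurable.comp hx).add
        ((toEuclideanLin S.B).continuous_of_finiteDimensional.measurable.comp
          ((toEuclideanLin LW).continuous_of_finiteDimensional.measurable.comp hW))).add
        ((toEuclideanLin S.BP).continuous_of_finiteDimensional.measurable.comp
          ((toEuclideanLin LP).continuous_of_finiteDimensional.measurable.comp
            (hP.sub hW)))).add (hω k)
    refine ⟨hx', sup_le hi (sup_le (outW_le (hβ _) hx') (outP_le _ (hv _) hx')), ?_⟩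
    exact ((((toEuclideanLin S.A).toContinuousLinearMap.comp_memLp' hx2).add
        ((toEuclideanLin S.B).toContinuousLinearMap.comp_memLp'
          ((toEuclideanLin LW).toContinuousLinearMap.comp_memLp' hW2))).add
        ((toEuclideanLin S.BP).toContinuousLinearMap.comp_memLp'
          ((toEuclideanLin LP).toContinuousLinearMap.comp_memLp' (hP2.sub hW2)))).add (hω2 k)

/-- Gains for which `A + B L^W` and `A + B^P L^P` are Schur stable bound the closed loop in mean
square as soon as `(A, H)` is detectable: the embedded estimation error is bounded by that of a
Luenberger observer, the remote one by that of a predictor which uses the correction `ũ^P`, and the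
state is a stable recursion driven by both errors and the noise. -/
theorem closedLoop_l2Bounded [IsProbabilityMeasure P] {μ : EuclideanSpace ℝ (Fin n)}
    {σ : Matrix (Fin n) (Fin n) ℝ} (hin : IsRandomInput S P μ σ x₀ ω v β)
    (hdet : Detectable S.A S.H) (hLW : lamMaxAbs (S.A + S.B * LW) < 1)
    (hLP : lamMaxAbs (S.A + S.BP * LP) < 1) :
    L2Bounded P fun k => (closedLoop S LW LP P x₀ ω v β k).x := by
  obtain ⟨K, hK⟩ := hdet
  have hω := L2Bounded.of_law_eq_multivariateGaussian hin.measurable_plant hin.law_plant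
  have hv := L2Bounded.of_law_eq_multivariateGaussian hin.measurable_sensor hin.law_sensor
  have hreg := closedLoop_measurable_memLp (S := S) (LW := LW) (LP := LP) hin.measurable_init
    hin.measurable_plant hin.measurable_sensor hin.measurable_channel
    (memLp_two_of_map_eq_multivariateGaussian hin.measurable_init hin.law_init) hω.memLp
  set s := closedLoop S LW LP P x₀ ω v β
  have hx : ∀ k, MemLp (s k).x 2 P := fun k => (hreg k).2.2
  have hWP : ∀ k, (s k).infoW ≤ (s k).infoP := closedLoop_infoW_le_infoP
  have hestW : ∀ k, StronglyMeasurable[(s k).infoW] ((s k).estW P) :=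
    fun _ => stronglyMeasurable_condExp
  have hestP : ∀ k, StronglyMeasurable[(s k).infoP] ((s k).estP P) :=
    fun _ => stronglyMeasurable_condExp
  have hrec : ∀ k a, (s (k + 1)).x a = toEuclideanLin S.A ((s k).x a)
      + toEuclideanLin S.B (toEuclideanLin LW ((s k).estW P a))
      + toEuclideanLin S.BP (toEuclideanLin LP ((s k).estP P a - (s k).estW P a)) + ω k a :=
    closedLoop_x_succ
  have hlin {ι κ : Type} [Fintype ι] [Fintype κ] [DecidableEq κ] {𝓖 : MeasurableSpace Ω}
      (N : Matrix ι κ ℝ) {f : Ω → EuclideanSpace ℝ κ} (hf : StronglyMeasurable[𝓖] f) :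
      StronglyMeasurable[𝓖] fun a => toEuclideanLin N (f a) :=
    (toEuclideanLin N).continuous_of_finiteDimensional.comp_stronglyMeasurable hf
  have heP : L2Bounded P fun k a => (s k).x a - (s k).estP P a := by
    refine L2Bounded.estimation_error (𝓕 := fun k => (s k).infoP) closedLoop_infoP_mono
      (fun k => (hreg k).2.1)
      (summable_norm_pow_of_lamMaxAbs_lt_one hK) hx
      -- Output injection: `A x = (A + K H) x - K y^P + K v`, which leaves the disturbance `ω + K
      -- v`.
      (φ := fun k a => toEuclideanLin S.B (toEuclideanLin LW ((s k).estW P a))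
        + toEuclideanLin S.BP (toEuclideanLin LP ((s k).estP P a - (s k).estW P a))
        - toEuclideanLin K (toEuclideanLin S.H ((s k).x a) + v k a)) (fun k => ?_)
      (hω.add (hv.lin (toEuclideanLin K))) (fun k a => ?_)
    · have hy : StronglyMeasurable[(s k).infoP]
          fun a => toEuclideanLin S.H ((s k).x a) + v k a :=
        ((comap_measurable _).mono (outP_le_closedLoop_infoP k) le_rfl).stronglyMeasurable
      have hW' := (hestW k).mono (hWP k)
      exact ((hlin S.B (hlin LW hW')).add (hlin S.BP (hlin LP ((hestP k).sub hW')))).sub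
        (hlin K hy)
    · simp only [hrec, toEuclideanCLM_add_mul]
      rw [map_add (toEuclideanLin K)]
      abel
  have heW : L2Bounded P fun k a => (s k).x a - (s k).estW P a := by
    refine L2Bounded.estimation_error (𝓕 := fun k => (s k).infoW) closedLoop_infoW_mono
      (fun k => (hWP k).trans (hreg k).2.1)
      (summable_norm_pow_of_lamMaxAbs_lt_one hLP) hx
      -- Since `x̂^P - x̂^W = x - x̂^W - (x - x̂^P)`, the correction adds `BP * LP` to the dynamics,
      -- and the unknown remainder is bounded by `heP`.
      (φ := fun k a => toEuclideanLin S.B (toEuclideanLin LW ((s k).estW P a))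
        - toEuclideanLin S.BP (toEuclideanLin LP ((s k).estW P a))) (fun k => ?_)
      (hω.sub ((heP.lin (toEuclideanLin LP)).lin (toEuclideanLin S.BP))) (fun k a => ?_)
    · exact (hlin S.B (hlin LW (hestW k))).sub (hlin S.BP (hlin LP (hestW k)))
    · simp only [hrec, toEuclideanCLM_add_mul, map_sub]
      abel
  -- Here `x̂^W = x - e^W` and `x̂^P - x̂^W = e^W - e^P`, where `e` denotes the estimation errors.
  refine L2Bounded.of_recursion (summable_norm_pow_of_lamMaxAbs_lt_one hLW) (hx 0)
    (((((heW.sub heP).lin (toEuclideanLin LP)).lin (toEuclideanLin S.BP)).sub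
      ((heW.lin (toEuclideanLin LW)).lin (toEuclideanLin S.B))).add hω) fun k a => ?_
  simp only [hrec, toEuclideanCLM_add_mul, map_sub]
  abel

end ClosedLoop

theorem L2Bounded.integral_norm_sq_le {Ω E : Type*} [MeasurableSpace Ω] {P : Measure Ω}
    [NormedAddCommGroup E] {f : ℕ → Ω → E} (hf : L2Bounded P f) :
    ∃ C : ℝ, ∀ k, Integrable (fun a => ‖f k a‖ ^ 2) P ∧ ∫ a, ‖f k a‖ ^ 2 ∂P ≤ C := by
  have hmem := hf.memLp
  obtain ⟨C, hC⟩ := hf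
  refine ⟨(C : ℝ) ^ 2, fun k => ⟨(hmem k).integrable_norm_pow (by norm_num), ?_⟩⟩
  have h := (hC k).2
  rw [(hmem k).eLpNorm_eq_integral_rpow_norm (by norm_num) (by norm_num),
    ENNReal.ofReal_le_iff_le_toReal ENNReal.coe_ne_top, ENNReal.coe_toReal] at h
  have hnn : 0 ≤ ∫ a, ‖f k a‖ ^ 2 ∂P := integral_nonneg fun a => by positivity
  simp only [ENNReal.toReal_ofNat, Real.rpow_ofNat, ← one_div, ← Real.sqrt_eq_rpow] at h
  exact (Real.sqrt_le_left C.2).1 h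

end NCS

theorem corollary2 {n nW nP m : ℕ} (S : NCS.System n nW nP m) (w : NCS.Weights n nW nP)
    -- the noise covariances and the dropout probability are legitimate
    (hQω : S.Qω.PosSemidef) (hQv : S.Qv.PosSemidef) (hp0 : 0 ≤ S.p) (hp1 : S.p ≤ 1)
    -- the weights are admissible
    (hRP : w.RP.PosDef) (hRW : w.RW.PosDef) (hQ : w.Q.PosSemidef)
    -- observability of the state weight, detectability of the sensor
    (hobs : NCS.Observable S.A (CFC.sqrt w.Q)) (hdet : NCS.Detectable S.A S.H)
    -- joint stabilizability by the two controllers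
    (hstab : NCS.Stabilizable S.A S.B)
    -- stabilizability by the embedded controller, and observability of the combined weight
    (hstabP : NCS.Stabilizable S.A S.BP)
    (hobsD : ∀ PW : Matrix (Fin n) (Fin n) ℝ, PW.PosDef → S.RiccatiW w PW →
      ∃ D : Matrix (Fin n) (Fin n) ℝ,
        S.p • w.Q + (1 - S.p) • PW = D * Dᵀ ∧ NCS.Observable S.A D)
    -- the eigenvalue condition, for the solution of the coupled Riccati equations
    (heig : ∀ PW PP : Matrix (Fin n) (Fin n) ℝ, S.RiccatiW w PW → S.RiccatiP w PW PP →
      PW.PosDef → (S.Del PW PP).PosDef →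
      ENNReal.ofReal (Real.sqrt S.p) *
        NCS.lamMaxAbs (S.A - S.BP * (S.Omg w PW PP)⁻¹ * S.L PW PP) < 1) :
    NCS.System.MeanSquareBounded.{u} S := by
  obtain ⟨LW, hLW⟩ := hstab
  obtain ⟨LP, hLP⟩ := hstabP
  exact ⟨LW, LP, fun Ω _ P _ μ σ x₀ ω v β _ hin =>
    (NCS.closedLoop_l2Bounded hin hdet hLW hLP).integral_norm_sq_le⟩
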